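/- Let $L$ be an arbitrary first-order signature (predicates, function symbols, and constants as $0$-place function symbols). An $L^+$-formula is a first-order $L$-formula with equality; an $L^-$-formula is one built without the symbol $=$, i.e. from $\bot$ and atomic formulas $P t_1\dots t_k$ with $P$ a predicate of $L$, by connectives and quantifiers. A relativity on an $L$-structure $N$ is a relation $\Pi\subseteq N\times N$ with domain $N$ and range $N$ such that, for all tuples $\bar d,\bar e$ with $d_i\,\Pi\,e_i$ for all $i$: $\bar d\in P^N$ iff $\bar e\in P^N$ for every $L$-predicate $P$, and $f^N(\bar d)\,\Pi\,f^N(\bar e)$ for every $L$-function symbol $f$. For $V\subseteq N^n$ put $\Pi(V)=\{\bar e\in N^n : d_i\,\Pi\,e_i \text{ for all } i, \text{ for some } \bar d\in V\}$. Let $R\notin L$ be an $n$-place predicate; $(N,V)$ denotes the $L\cup\{R\}$-structure expanding $N$ in which $R$ is interpreted as $V$. For structures $A,B$ of one signature $K$, $B\succ^+A$ (respectively $B\succ^-A$) means that the domain of $A$ is included in that of $B$ (up to renaming elements), and that $A\models\varphi(\bar e)$ iff $B\models\varphi(\bar e)$ for all $k$, all $K^+$-formulas (respectively $K^-$-formulas)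 $\varphi(v_1,\dots,v_k)$ and all $\bar e\in A^k$. Theorem (Beth–Svenonius theorem, equality-free case). For every $L$-structure $M$, every $n\ge 0$ and every $U\subseteq M^n$, the following are equivalent: (1) $(M,U)\models\forall\bar v\,(\varphi(\bar v)\leftrightarrow R\bar v)$ for some $L^-$-formula $\varphi(v_1,\dots,v_n)$. (2) For every $(N,V)\succ^+(M,U)$ and every relativity $\Pi$ on the $L$-structure $N$: $V=\Pi(V)$. (3) For every $(N,V)\succ^-(M,U)$ and every relativity $\Pi$ on the $L$-structure $N$: $V=\Pi(V)$. (4) For every $L$-structure $N$ and all $V_0,V_1\subseteq N^n$: if $(N,V_0)$, $(N,V_1)$ and $(M,U)$ all satisfy the same equality-free $L\cup\{R\}$-sentences, then $V_0=V_1$. -/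

import Mathlib

open FirstOrder FirstOrder.Language

universe u v w w' x

namespace EqFree

/-- A formula is equality-free if it is built from `⊥` and atomic formulas `R t₁ … t_l`, with `R` a
predicate of the signature, by connectives and quantifiers, without the symbol `=`. -/
def IsEqFree {L : FirstOrder.Language.{u, v}} {α : Type w} : ∀ {k : ℕ}, L.BoundedFormula α k → Prop
  | _, .falsum => True
  | _, .equal _ _ => False
  | _, .rel _ _ => True
  | _, .imp φ ψ => IsEqFree φ ∧ IsEqFree ψ
  | _, .all φ => IsEqFree φ

/-- The predicate symbols of the signature `{R}`: a single one, of arity `n`. -/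
inductive PredSymbol (n : ℕ) : ℕ → Type
  | R : PredSymbol n n

/-- The signature `{R}` with `R` an `n`-place predicate. -/
def predLanguage (n : ℕ) : FirstOrder.Language.{0, 0} where
  Functions := fun _ => Empty
  Relations := PredSymbol n

/-- The signature `L ∪ {R}`, with `R ∉ L` an `n`-place predicate. -/
abbrev addPred (L : FirstOrder.Language.{u, v}) (n : ℕ) : FirstOrder.Language.{u, v} :=
  L.sum (predLanguage n)

/-- The new predicate symbol `R` of `L ∪ {R}`. -/
def newPred (L : FirstOrder.Language.{u, v}) (n : ℕ) : (addPred L n).Relations n :=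
  Sum.inr PredSymbol.R

/-- The domain of the structure `(M, U)`. -/
def Expand {M : Type w} {n : ℕ} (_U : Set (Fin n → M)) : Type w := M

/-- The `L ∪ {R}`-structure `(M, U)`: the symbols of `L` are read as in `M`, and `R` as `U`. -/
instance Expand.instStructure {L : FirstOrder.Language.{u, v}} {M : Type w} [L.Structure M] {n : ℕ}
    (U : Set (Fin n → M)) : (addPred L n).Structure (Expand U) where
  funMap := fun f x =>
    match f with
    | Sum.inl f => Structure.funMap (L := L) (M := M) f x
  RelMap := fun r x =>
    match r, x with
    | Sum.inl r, x => Structure.RelMap (L := L) (M := M) r x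
    | Sum.inr PredSymbol.R, x => (show Fin n → M from x) ∈ U

/-- The `L ∪ {R}`-sentence `∀ v₁ … v_n (φ(v₁, …, v_n) ↔ R v₁ … v_n)`. -/
noncomputable def defSentence {L : FirstOrder.Language.{u, v}} {n : ℕ} (φ : L.Formula (Fin n)) :
    (addPred L n).Sentence :=
  Formula.iAlls (Fin n) (Formula.relabel Sum.inr
    (Formula.iff ((LHom.sumInl : L →ᴸ addPred L n).onFormula φ)
      ((newPred L n).formula fun i => Term.var i)))

/-- `j` exhibits `B` as an equality-free elementary extension of `A`. Only formulas without
equality are preserved, so that `j` need not commute with the function symbols. -/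
structure IsEqFreeElementary (L : FirstOrder.Language.{u, v}) {A : Type w} {B : Type w'} [L.Structure A]
    [L.Structure B] (j : A → B) : Prop where
  injective : Function.Injective j
  realize_iff : ∀ (k : ℕ) (φ : L.Formula (Fin k)), IsEqFree φ →
    ∀ e : Fin k → A, φ.Realize e ↔ φ.Realize (j ∘ e)

/-- `A` and `B` satisfy the same equality-free `L`-sentences. -/
def EqFreeEquiv (L : FirstOrder.Language.{u, v}) (A : Type w) (B : Type w') [L.Structure A]
    [L.Structure B] : Prop :=
  ∀ σ : L.Sentence, IsEqFree σ → (A ⊨ σ ↔ B ⊨ σ)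

/-- Relativeness correspondences from `M` to `N`. -/
structure IsRelativenessCorrespondence (L : FirstOrder.Language.{u, v}) {M : Type w} {N : Type w'}
    [L.Structure M] [L.Structure N] (P : M → N → Prop) : Prop where
  dom : ∀ d, ∃ e, P d e
  rng : ∀ e, ∃ d, P d e
  rel_iff : ∀ (k : ℕ) (r : L.Relations k) (d : Fin k → M) (e : Fin k → N),
    (∀ i, P (d i) (e i)) → (Structure.RelMap r d ↔ Structure.RelMap r e)
  map_fun : ∀ (k : ℕ) (f : L.Functions k) (d : Fin k → M) (e : Fin k → N),
    (∀ i, P (d i) (e i)) → P (Structure.funMap f d) (Structure.funMap f e)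

/-- A relativity on `M` is a relativeness correspondence from `M` to itself. -/
abbrev IsRelativity (L : FirstOrder.Language.{u, v}) {M : Type w} [L.Structure M] (P : M → M → Prop) : Prop :=
  IsRelativenessCorrespondence L P

/-- The image `P(V)` of a set of `n`-tuples under a binary relation `P`. -/
def relImage {M : Type w} {N : Type w'} {n : ℕ} (P : M → N → Prop) (V : Set (Fin n → M)) :
    Set (Fin n → N) :=
  {e | ∃ d ∈ V, ∀ i, P (d i) (e i)}

end EqFree

/-! Definability gives (4) because the defining sentence is itself equality-free. For (4) to (3),
the graph of a relativity is an `L`-structure whose two projections are relativeness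
correspondences; pulling `V` back along each gives two expansions equivalent to `(N, V)`, hence
equal by (4) (`mem_iff_of_relativity`). For (3) to (2), elementary embeddings preserve equality-free
formulas in particular.

The substance is (2) to (1), by contraposition. If `U` is not definable, some ultrapower has tuples
`d`, `e` of the same equality-free `L`-type with only `d` in `R`
(`exists_sameType_of_not_definable`). The relation pairing `d i` with `e i` preserves types.
Alternating ultrapowers and the union of an elementary chain extend it to full domain and range
(`PreservesTypes.exists_full_extension`). Its closure under terms is a relativity
(`PreservesTypes.exists_isRelativity`), and it carries a tuple in `R` to one outside. Equality never
interferes, since a type-preserving relation need not be a function. -/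

namespace EqFree

/-! ### Closure of equality-free formulas under syntactic operations -/

section EqFreeFormulas

variable {L : FirstOrder.Language.{u, v}} {α β : Type*} {k : ℕ}

theorem IsEqFree.not {φ : L.BoundedFormula α k} (h : IsEqFree φ) : IsEqFree φ.not :=
  ⟨h, trivial⟩

theorem IsEqFree.inf {φ ψ : L.BoundedFormula α k} (hφ : IsEqFree φ) (hψ : IsEqFree ψ) :
    IsEqFree (φ ⊓ ψ) :=
  ⟨⟨hφ, hψ, trivial⟩, trivial⟩

theorem IsEqFree.ex {φ : L.BoundedFormula α (k + 1)} (h : IsEqFree φ) : IsEqFree φ.ex :=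
  ⟨⟨h, trivial⟩, trivial⟩

theorem IsEqFree.alls : ∀ {k : ℕ} {φ : L.BoundedFormula α k}, IsEqFree φ → IsEqFree φ.alls
  | 0, _, h => h
  | _ + 1, φ, h => IsEqFree.alls (φ := φ.all) h

theorem IsEqFree.exs : ∀ {k : ℕ} {φ : L.BoundedFormula α k}, IsEqFree φ → IsEqFree φ.exs
  | 0, _, h => h
  | _ + 1, φ, h => IsEqFree.exs (φ := φ.ex) h.ex

theorem IsEqFree.castLE {φ : L.BoundedFormula α k} (h : IsEqFree φ) :
    ∀ {m : ℕ} (hm : k ≤ m), IsEqFree (φ.castLE hm) := by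
  induction φ with
  | falsum => exact fun _ => trivial
  | equal => exact h.elim
  | rel => exact fun _ => trivial
  | imp _ _ ih₁ ih₂ => exact fun hm => ⟨ih₁ h.1 hm, ih₂ h.2 hm⟩
  | all _ ih => exact fun hm => ih h (Nat.succ_le_succ hm)

theorem IsEqFree.mapTermRel {L' : FirstOrder.Language} {g : ℕ → ℕ}
    (ft : ∀ n, L.Term (α ⊕ (Fin n)) → L'.Term (β ⊕ (Fin (g n))))
    (fr : ∀ n, L.Relations n → L'.Relations n)
    (c : ∀ n, L'.BoundedFormula β (g (n + 1)) → L'.BoundedFormula β (g n + 1))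
    (hc : ∀ n φ, IsEqFree φ → IsEqFree (c n φ)) {φ : L.BoundedFormula α k} (h : IsEqFree φ) :
    IsEqFree (φ.mapTermRel ft fr c) := by
  induction φ with
  | falsum => trivial
  | equal => exact h.elim
  | rel => trivial
  | imp _ _ ih₁ ih₂ => exact ⟨ih₁ h.1, ih₂ h.2⟩
  | all _ ih => exact hc _ _ (ih h)

theorem IsEqFree.boundedRelabel {m : ℕ} (g : α → β ⊕ (Fin m)) {φ : L.BoundedFormula α k}
    (h : IsEqFree φ) : IsEqFree (φ.relabel g) :=
  h.mapTermRel _ _ _ fun _ _ h => h.castLE _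

theorem IsEqFree.relabel (g : α → β) {φ : L.Formula α} (h : IsEqFree φ) :
    IsEqFree (Formula.relabel g φ) :=
  IsEqFree.boundedRelabel _ h

theorem IsEqFree.iAlls [Finite β] {φ : L.Formula (α ⊕ β)} (h : IsEqFree φ) :
    IsEqFree (φ.iAlls β) :=
  IsEqFree.alls (IsEqFree.boundedRelabel _ h)

theorem IsEqFree.iExs [Finite β] {φ : L.Formula (α ⊕ β)} (h : IsEqFree φ) :
    IsEqFree (φ.iExs β) :=
  IsEqFree.exs (IsEqFree.boundedRelabel _ h)

theorem IsEqFree.restrictFreeVar [DecidableEq α] {φ : L.BoundedFormula α k} (h : IsEqFree φ)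
    (f : φ.freeVarFinset → β) : IsEqFree (φ.restrictFreeVar f) := by
  induction φ with
  | falsum => trivial
  | equal => exact h.elim
  | rel => trivial
  | imp _ _ ih₁ ih₂ => exact ⟨ih₁ h.1 _, ih₂ h.2 _⟩
  | all _ ih => exact ih h _

theorem IsEqFree.onBoundedFormula {L' : FirstOrder.Language} (ψ : L →ᴸ L')
    {φ : L.BoundedFormula α k} (h : IsEqFree φ) : IsEqFree (ψ.onBoundedFormula φ) := by
  induction φ with
  | falsum => trivial
  | equal => exact h.elim
  | rel => trivial
  | imp _ _ ih₁ ih₂ => exact ⟨ih₁ h.1, ih₂ h.2⟩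
  | all _ ih => exact ih h

theorem isEqFree_defSentence {n : ℕ} {φ : L.Formula (Fin n)} (h : IsEqFree φ) :
    IsEqFree (defSentence φ) := by
  have h' : IsEqFree ((LHom.sumInl : L →ᴸ addPred L n).onFormula φ) := h.onBoundedFormula _
  exact IsEqFree.iAlls (IsEqFree.relabel _ (IsEqFree.inf (φ := BoundedFormula.imp _ _)
    (ψ := BoundedFormula.imp _ _) ⟨h', trivial⟩ ⟨trivial, h'⟩))

end EqFreeFormulas

/-! ### Relativeness correspondences preserve equality-free formulas -/

section Correspondence

variable {L : FirstOrder.Language.{u, v}} {M : Type w} {N : Type w'} [L.Structure M]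
  [L.Structure N] {P : M → N → Prop} {α : Type*}

theorem IsRelativenessCorrespondence.realize_term (hP : IsRelativenessCorrespondence L P)
    {d : α → M} {e : α → N} (h : ∀ i, P (d i) (e i)) (t : L.Term α) :
    P (t.realize d) (t.realize e) := by
  induction t with
  | var i => exact h i
  | func f ts ih => exact hP.map_fun _ f _ _ ih

/-- A back-and-forth in one step: full domain and range supply the partner of a quantified element,
and any partner will do. -/
theorem IsRelativenessCorrespondence.realize_boundedFormula
    (hP : IsRelativenessCorrespondence L P) {d : α → M} {e : α → N} (h : ∀ i, P (d i) (e i))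
    {k : ℕ} {φ : L.BoundedFormula α k} (hφ : IsEqFree φ) {xs : Fin k → M} {ys : Fin k → N}
    (hxy : ∀ i, P (xs i) (ys i)) : φ.Realize d xs ↔ φ.Realize e ys := by
  induction φ with
  | falsum => exact Iff.rfl
  | equal => exact hφ.elim
  | rel r ts =>
    refine hP.rel_iff _ r _ _ fun i => hP.realize_term (fun a => ?_) _
    cases a with
    | inl a => exact h a
    | inr a => exact hxy a
  | imp _ _ ih₁ ih₂ => exact imp_congr (ih₁ hφ.1 hxy) (ih₂ hφ.2 hxy)
  | all φ ih =>
    have key : ∀ a b, P a b → (φ.Realize d (Fin.snoc xs a) ↔ φ.Realize e (Fin.snoc ys b)) := by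
      intro a b hab
      refine ih hφ fun i => ?_
      refine Fin.lastCases ?_ (fun i => ?_) i
      · simpa using hab
      · simpa using hxy i
    constructor
    · intro H b
      obtain ⟨a, hab⟩ := hP.rng b
      exact (key a b hab).1 (H a)
    · intro H a
      obtain ⟨b, hab⟩ := hP.dom a
      exact (key a b hab).2 (H b)

theorem IsRelativenessCorrespondence.realize_formula (hP : IsRelativenessCorrespondence L P)
    {φ : L.Formula α} (hφ : IsEqFree φ) {d : α → M} {e : α → N} (h : ∀ i, P (d i) (e i)) :
    φ.Realize d ↔ φ.Realize e :=
  hP.realize_boundedFormula h hφ fun i => i.elim0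

theorem IsRelativenessCorrespondence.eqFreeEquiv (hP : IsRelativenessCorrespondence L P) :
    EqFreeEquiv L M N :=
  fun _ hσ => hP.realize_formula hσ fun i => i.elim

end Correspondence

/-! ### The expansions `(M, U)` -/

section Expand

variable {L : FirstOrder.Language.{u, v}} {M : Type w} [L.Structure M] {n : ℕ}

instance Expand.instBase (U : Set (Fin n → M)) : L.Structure (Expand U) :=
  inferInstanceAs (L.Structure M)

instance Expand.instIsExpansionOn (U : Set (Fin n → M)) :
    (LHom.sumInl : L →ᴸ addPred L n).IsExpansionOn (Expand U) :=
  ⟨fun _ _ => rfl, fun _ _ => rfl⟩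

theorem realize_onFormula_expand {α : Type*} (U : Set (Fin n → M)) (φ : L.Formula α)
    (e : α → M) :
    ((LHom.sumInl : L →ᴸ addPred L n).onFormula φ).Realize (M := Expand U) e ↔ φ.Realize e :=
  LHom.realize_onFormula (M := Expand U) _ φ

theorem realize_defSentence (U : Set (Fin n → M)) (φ : L.Formula (Fin n)) :
    Expand U ⊨ defSentence φ ↔ ∀ e : Fin n → M, φ.Realize e ↔ e ∈ U := by
  unfold defSentence Sentence.Realize
  rw [Formula.realize_iAlls]
  refine forall_congr' fun e => ?_
  rw [Formula.realize_relabel]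
  change Formula.Realize (BoundedFormula.iff _ _) _ ↔ _
  rw [Formula.Realize, BoundedFormula.realize_iff]
  exact iff_congr (realize_onFormula_expand U φ e) Iff.rfl

theorem IsEqFreeElementary.eqFreeEquiv {L : FirstOrder.Language.{u, v}} {A : Type w}
    {B : Type w'} [L.Structure A] [L.Structure B] {j : A → B} (hj : IsEqFreeElementary L j) :
    EqFreeEquiv L A B := by
  intro σ hσ
  have h := hj.realize_iff 0 (Formula.relabel Empty.elim σ) (hσ.relabel _) Fin.elim0
  rw [Formula.realize_relabel, Formula.realize_relabel] at h
  simp only [Sentence.Realize]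
  convert! h using 2

theorem EqFreeEquiv.trans {A B C : Type*} [L.Structure A] [L.Structure B] [L.Structure C]
    (h : EqFreeEquiv L A B) (h' : EqFreeEquiv L B C) : EqFreeEquiv L A C :=
  fun σ hσ => (h σ hσ).trans (h' σ hσ)

theorem EqFreeEquiv.symm {A B : Type*} [L.Structure A] [L.Structure B]
    (h : EqFreeEquiv L A B) : EqFreeEquiv L B A :=
  fun σ hσ => (h σ hσ).symm

end Expand

/-! ### The graph of a relativity as a structure -/

section Graph

variable {L : FirstOrder.Language.{u, v}} {N : Type w} [L.Structure N] {P : N → N → Prop}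
  {n : ℕ}

/-- The graph of a relativity, with the operations taken componentwise. -/
abbrev graphStructure (hP : IsRelativity L P) : L.Structure {p : N × N // P p.1 p.2} where
  funMap f x := ⟨(Structure.funMap f fun i => (x i).1.1, Structure.funMap f fun i => (x i).1.2),
    hP.map_fun _ f _ _ fun i => (x i).2⟩
  RelMap r x := Structure.RelMap r fun i => (x i).1.1

/-- The first projection is a relativeness correspondence, onto because `P` has full domain. -/
theorem eqFreeEquiv_graph_fst (hP : IsRelativity L P) (V : Set (Fin n → N)) :
    letI := graphStructure hP
    EqFreeEquiv (addPred L n)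
      (Expand {x : Fin n → {p : N × N // P p.1 p.2} | (fun i => (x i).1.1) ∈ V}) (Expand V) := by
  let := graphStructure hP
  refine IsRelativenessCorrespondence.eqFreeEquiv
    (P := fun (p : {p : N × N // P p.1 p.2}) (a : N) => p.1.1 = a) ⟨fun p => ⟨_, rfl⟩, ?_, ?_, ?_⟩
  · intro a
    obtain ⟨b, hb⟩ := hP.dom a
    exact ⟨⟨(a, b), hb⟩, rfl⟩
  · intro k r d e h
    obtain rfl := funext h
    obtain r | r := r
    · exact Iff.rfl
    · change PredSymbol n k at r
      cases r
      exact Iff.rfl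
  · intro k f d e h
    obtain rfl := funext h
    match f with
    | Sum.inl f => rfl

/-- Predicates on the graph are read from first coordinates; as `P` respects them, the second
projection respects them too. -/
theorem eqFreeEquiv_graph_snd (hP : IsRelativity L P) (V : Set (Fin n → N)) :
    letI := graphStructure hP
    EqFreeEquiv (addPred L n)
      (Expand {x : Fin n → {p : N × N // P p.1 p.2} | (fun i => (x i).1.2) ∈ V}) (Expand V) := by
  let := graphStructure hP
  refine IsRelativenessCorrespondence.eqFreeEquiv
    (P := fun (p : {p : N × N // P p.1 p.2}) (a : N) => p.1.2 = a) ⟨fun p => ⟨_, rfl⟩, ?_, ?_, ?_⟩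
  · intro b
    obtain ⟨a, ha⟩ := hP.rng b
    exact ⟨⟨(a, b), ha⟩, rfl⟩
  · intro k r d e h
    obtain rfl := funext h
    obtain r | r := r
    · exact hP.rel_iff _ r _ _ fun i => (d i).2
    · change PredSymbol n k at r
      cases r
      exact Iff.rfl
  · intro k f d e h
    obtain rfl := funext h
    match f with
    | Sum.inl f => rfl

end Graph

/-! ### Finitely many equality-free formulas -/

section FiniteTypes

variable {L : FirstOrder.Language.{u, v}} {α : Type*} {M : Type w} [L.Structure M]

/-- The conditions imposed on a tuple by finitely many equality-free formulas true or false at a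
given tuple amount to one equality-free formula. -/
theorem exists_isEqFree_realize_iff_agree (s : Finset {φ : L.Formula α // IsEqFree φ})
    (l : α → M) : ∃ χ : L.Formula α, IsEqFree χ ∧
      ∀ r : α → M, χ.Realize r ↔ ∀ φ ∈ s, (φ.1.Realize l ↔ φ.1.Realize r) := by
  classical
  induction s using Finset.induction_on with
  | empty => exact ⟨⊤, IsEqFree.not (φ := ⊥) trivial, by simp⟩
  | insert φ s _ ih =>
    obtain ⟨χ, hχ, h⟩ := ih
    by_cases hl : φ.1.Realize l
    · exact ⟨φ.1 ⊓ χ, φ.2.inf hχ, fun r => by simp [h, hl]⟩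
    · exact ⟨φ.1.not ⊓ χ, φ.2.not.inf hχ, fun r => by simp [h, hl]⟩

/-- A set which is a union of classes of agreement on finitely many equality-free formulas is
definable by an equality-free formula. -/
theorem exists_isEqFree_realize_iff_mem (s : Finset {φ : L.Formula α // IsEqFree φ}) :
    ∀ U : Set (α → M),
      (∀ d ∈ U, ∀ e, (∀ φ ∈ s, (φ.1.Realize d ↔ φ.1.Realize e)) → e ∈ U) →
      ∃ χ : L.Formula α, IsEqFree χ ∧ ∀ e, χ.Realize e ↔ e ∈ U := by
  classical
  induction s using Finset.induction_on with
  | empty =>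
    intro U hU
    obtain rfl | ⟨d, hd⟩ := U.eq_empty_or_nonempty
    · exact ⟨⊥, trivial, by simp⟩
    · exact ⟨⊤, IsEqFree.not (φ := ⊥) trivial, fun e => by simpa using hU d hd e (by simp)⟩
  | insert φ s _ ih =>
    intro U hU
    -- Saturating under `s`-agreement the part of `U` where `φ` has truth value `p` gives a set
    -- covered by the induction hypothesis; `U` is then recovered by cases on `φ`.
    have key : ∀ p : Prop, ∃ χ : L.Formula α, IsEqFree χ ∧ ∀ e : α → M, χ.Realize e ↔
        ∃ d ∈ U, (φ.1.Realize d ↔ p) ∧ ∀ ψ ∈ s, (ψ.1.Realize d ↔ ψ.1.Realize e) := by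
      intro p
      refine ih {e | ∃ d ∈ U, (φ.1.Realize d ↔ p) ∧
        ∀ ψ ∈ s, (ψ.1.Realize d ↔ ψ.1.Realize e)} ?_
      rintro d ⟨c, hc, hp, hcd⟩ e hde
      exact ⟨c, hc, hp, fun ψ hψ => (hcd ψ hψ).trans (hde ψ hψ)⟩
    obtain ⟨χ₁, h₁, H₁⟩ := key True
    obtain ⟨χ₂, h₂, H₂⟩ := key False
    refine ⟨φ.1.imp χ₁ ⊓ φ.1.not.imp χ₂,
      IsEqFree.inf (φ := BoundedFormula.imp _ _) (ψ := BoundedFormula.imp _ _)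
        ⟨φ.2, h₁⟩ ⟨φ.2.not, h₂⟩, fun e => ?_⟩
    rw [Formula.realize_inf, Formula.realize_imp, Formula.realize_imp, Formula.realize_not,
      H₁, H₂]
    constructor
    · rintro ⟨H, H'⟩
      by_cases he : φ.1.Realize e
      · obtain ⟨d, hd, hp, hde⟩ := H he
        refine hU d hd e fun ψ hψ => ?_
        obtain rfl | hψ := Finset.mem_insert.1 hψ
        · simp_all
        · exact hde ψ hψ
      · obtain ⟨d, hd, hp, hde⟩ := H' he
        refine hU d hd e fun ψ hψ => ?_
        obtain rfl | hψ := Finset.mem_insert.1 hψ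
        · simp_all
        · exact hde ψ hψ
    · intro he
      exact ⟨fun h => ⟨e, he, by simp [h], fun _ _ => Iff.rfl⟩,
        fun h => ⟨e, he, by simp [h], fun _ _ => Iff.rfl⟩⟩

end FiniteTypes

/-! ### Type-preserving relations -/

section SameType

variable {L K : FirstOrder.Language.{u, v}} {B : Type w} {T T' : Type*} [K.Structure B]

/-- The families `l` and `r` have the same equality-free type in the reduct along `ψ`. -/
def SameType (ψ : L →ᴸ K) (l r : T → B) : Prop :=
  ∀ φ : L.Formula T, IsEqFree φ → ((ψ.onFormula φ).Realize l ↔ (ψ.onFormula φ).Realize r)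

theorem realize_onFormula_relabel (ψ : L →ᴸ K) (φ : L.Formula T) (g : T → T') (v : T' → B) :
    (ψ.onFormula (φ.relabel g)).Realize v ↔ (ψ.onFormula φ).Realize (v ∘ g) := by
  let := ψ.reduct B
  rw [LHom.realize_onFormula, LHom.realize_onFormula, Formula.realize_relabel]

variable {ψ : L →ᴸ K}

theorem SameType.symm {l r : T → B} (h : SameType ψ l r) : SameType ψ r l :=
  fun φ hφ => (h φ hφ).symm

theorem SameType.comp {l r : T → B} (h : SameType ψ l r) (g : T' → T) :
    SameType ψ (l ∘ g) (r ∘ g) := by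
  intro φ hφ
  have := h (φ.relabel g) (hφ.relabel g)
  rwa [realize_onFormula_relabel, realize_onFormula_relabel] at this

/-- Related families have the same equality-free type in the reduct along `ψ`. -/
def PreservesTypes (ψ : L →ᴸ K) (S : B → B → Prop) : Prop :=
  SameType ψ (fun p : {p : B × B // S p.1 p.2} => p.1.1) (fun p => p.1.2)

theorem PreservesTypes.sameType {S : B → B → Prop} (hS : PreservesTypes ψ S) {l r : T → B}
    (h : ∀ t, S (l t) (r t)) : SameType ψ l r :=
  SameType.comp hS fun t => ⟨(l t, r t), h t⟩

/-- Choosing an index for each related pair makes the family of all pairs a reindexing of `l`, `r`.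
-/
theorem SameType.preservesTypes {l r : T → B} (h : SameType ψ l r) :
    PreservesTypes ψ fun a b => ∃ t, l t = a ∧ r t = b := by
  choose g hl hr using fun p : {p : B × B // ∃ t, l t = p.1 ∧ r t = p.2} => p.2
  have := h.comp g
  rwa [show l ∘ g = _ from funext hl, show r ∘ g = _ from funext hr] at this

theorem PreservesTypes.flip {S : B → B → Prop} (hS : PreservesTypes ψ S) :
    PreservesTypes ψ fun a b => S b a :=
  (hS.sameType (l := fun p : {p : B × B // S p.2 p.1} => p.1.2) (r := fun p => p.1.1)
    fun p => p.2).symm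

/-- The finitely satisfiable part of extending the domain of a type-preserving relation. -/
theorem SameType.exists_extension {l r : T → B} (h : SameType ψ l r) {T' : Type*} (m : T' → B)
    (s : Finset {φ : L.Formula (T ⊕ T') // IsEqFree φ}) :
    ∃ m' : T' → B, ∀ φ ∈ s, ((ψ.onFormula φ.1).Realize (Sum.elim l m) ↔
      (ψ.onFormula φ.1).Realize (Sum.elim r m')) := by
  classical
  let := ψ.reduct B
  simp only [SameType, LHom.realize_onFormula] at h ⊢
  obtain ⟨χ, hχ, H⟩ := exists_isEqFree_realize_iff_agree s (Sum.elim l m)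
  -- Variables from `T` stay free and those from `T'` are to be quantified away. Indexing the
  -- quantifiers by the finite set of all free variables adds only dummy ones.
  let f : χ.freeVarFinset → T ⊕ χ.freeVarFinset := fun a =>
    match a with
    | ⟨Sum.inl t, _⟩ => Sum.inl t
    | ⟨Sum.inr t, ht⟩ => Sum.inr ⟨Sum.inr t, ht⟩
  have h₁ : (Formula.iExs χ.freeVarFinset (χ.restrictFreeVar f)).Realize l := by
    rw [Formula.realize_iExs]
    refine ⟨fun a => Sum.elim l m a.1, ?_⟩
    refine (BoundedFormula.realize_restrictFreeVar (Sum.elim l m) ?_).2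
      ((H _).2 fun _ _ => Iff.rfl)
    rintro ⟨t | t, ht⟩ <;> rfl
  rw [h _ (IsEqFree.iExs (hχ.restrictFreeVar f)), Formula.realize_iExs] at h₁
  obtain ⟨i, hi⟩ := h₁
  refine ⟨fun t => if ht : Sum.inr t ∈ χ.freeVarFinset then i ⟨Sum.inr t, ht⟩ else m t,
    (H _).1 ((BoundedFormula.realize_restrictFreeVar _ ?_).1 hi)⟩
  rintro ⟨t | t, ht⟩
  · rfl
  · simp [f, ht]

end SameType

/-! ### Ultrapowers -/

section Ultrapower

open Filter

variable {K : FirstOrder.Language.{u, v}} {B : Type w} [K.Structure B] [Nonempty B]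

variable {I : Type*}

/-- The element of an ultrapower represented by a family. -/
def ultraMk (U : Ultrafilter I) (c : I → B) : (U : Filter I).Product (fun _ => B) :=
  ((c : ∀ _ : I, B) : (U : Filter I).Product fun _ => B)

theorem realize_ultraMk {T : Type*} (U : Ultrafilter I) (φ : K.Formula T) (c : T → I → B) :
    (φ.Realize fun t => ultraMk U (c t)) ↔
      ∀ᶠ i in (U : Filter I), φ.Realize fun t => c t i :=
  Ultraproduct.realize_formula_cast (u := U) (M := fun _ => B) φ c

theorem relMap_ultraMk {n : ℕ} (U : Ultrafilter I) (r : K.Relations n) (c : Fin n → I → B) :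
    Structure.RelMap r (fun t => ultraMk U (c t)) ↔
      ∀ᶠ i in (U : Filter I), Structure.RelMap r fun t => c t i :=
  realize_ultraMk U (r.formula Term.var) c

variable (K B) in
/-- The diagonal embedding of a structure into an ultrapower. -/
def diagonal (U : Ultrafilter I) : B ↪ₑ[K] (U : Filter I).Product (fun _ => B) where
  toFun b := ultraMk U fun _ => b
  map_formula' _ φ x := (realize_ultraMk U φ fun i _ => x i).trans eventually_const

/-- With `X` a set of formulas, a choice that works for each finite subset then yields, by Łoś, one
that works for all of `X`. -/
theorem exists_ultrafilter_mem (X : Type*) :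
    ∃ U : Ultrafilter (Finset X), ∀ a, ∀ᶠ s in (U : Filter (Finset X)), a ∈ s := by
  refine ⟨Ultrafilter.of atTop, fun a => Ultrafilter.of_le _ ?_⟩
  filter_upwards [eventually_ge_atTop {a}] with s hs
  exact hs (Finset.mem_singleton_self a)

end Ultrapower

/-! ### Realizing types in ultrapowers -/

section Step

open Filter

variable {L K : FirstOrder.Language.{u, v}} {ψ : L →ᴸ K}

/-- The variables are all pairs of `S` together with all elements of `B`, so partners for every
element are found simultaneously. New elements of the ultrapower may still lack partners. -/
theorem PreservesTypes.exists_domain_extension {B : Type (max u v w)} [K.Structure B]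
    [Nonempty B] {S : B → B → Prop} (hS : PreservesTypes ψ S) :
    ∃ (B' : Type (max u v w)) (_ : K.Structure B') (j : B ↪ₑ[K] B') (S' : B' → B' → Prop),
      PreservesTypes ψ S' ∧ (∀ a b, S a b → S' (j a) (j b)) ∧ ∀ a, ∃ b, S' (j a) b := by
  let X := {φ : L.Formula ({p : B × B // S p.1 p.2} ⊕ B) // IsEqFree φ}
  obtain ⟨U, hU⟩ := exists_ultrafilter_mem X
  choose m hm using SameType.exists_extension hS (id : B → B)
  let r : {p : B × B // S p.1 p.2} ⊕ B → Finset X → B := fun t s =>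
    Sum.elim (fun p : {p : B × B // S p.1 p.2} => p.1.2) (m s) t
  let j : B ↪ₑ[K] (U : Filter (Finset X)).Product (fun _ => B) := diagonal K B U
  let l : {p : B × B // S p.1 p.2} ⊕ B → B := Sum.elim (fun p => p.1.1) id
  have key : SameType ψ (j ∘ l)
      (fun t => ultraMk U (r t)) := by
    intro φ hφ
    rw [j.map_formula, realize_ultraMk]
    have : ∀ᶠ s in (U : Filter (Finset X)), ((ψ.onFormula φ).Realize l ↔
        (ψ.onFormula φ).Realize fun t => r t s) := by
      filter_upwards [hU ⟨φ, hφ⟩] with s hs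
      exact hm s _ hs
    rw [← eventually_congr this]
    simp
  refine ⟨_, inferInstance, j, _, key.preservesTypes, fun a b hab => ?_, fun a => ?_⟩
  · exact ⟨Sum.inl ⟨(a, b), hab⟩, rfl, rfl⟩
  · exact ⟨_, Sum.inr a, rfl, rfl⟩

theorem PreservesTypes.exists_total_extension {B : Type (max u v w)} [K.Structure B]
    [Nonempty B] {S : B → B → Prop} (hS : PreservesTypes ψ S) :
    ∃ (B' : Type (max u v w)) (_ : K.Structure B') (j : B ↪ₑ[K] B') (S' : B' → B' → Prop),
      PreservesTypes ψ S' ∧ (∀ a b, S a b → S' (j a) (j b)) ∧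
        (∀ a, ∃ b, S' (j a) b) ∧ ∀ b, ∃ a, S' a (j b) := by
  obtain ⟨B₁, _, j₁, S₁, h₁, hj₁, hd⟩ := PreservesTypes.exists_domain_extension.{u, v, w} hS
  have : Nonempty B₁ := ‹Nonempty B›.map j₁
  obtain ⟨B₂, _, j₂, S₂, h₂, hj₂, hr⟩ :=
    PreservesTypes.exists_domain_extension.{u, v, w} h₁.flip
  refine ⟨B₂, ‹_›, j₂.comp j₁, fun a b => S₂ b a, h₂.flip,
    fun a b hab => hj₂ _ _ (hj₁ _ _ hab), fun a => ?_, fun b => hr (j₁ b)⟩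
  obtain ⟨b, hb⟩ := hd a
  exact ⟨j₂ b, hj₂ _ _ hb⟩

/-- If the predicate `r` is not definable by an equality-free formula of the smaller signature, then
some elementary extension has two tuples of the same type of which only one satisfies `r`. -/
theorem exists_sameType_of_not_definable {M : Type w'} [K.Structure M] {n : ℕ}
    (r : K.Relations n)
    (h : ¬ ∃ φ : L.Formula (Fin n), IsEqFree φ ∧
      ∀ e : Fin n → M, (ψ.onFormula φ).Realize e ↔ Structure.RelMap r e) :
    ∃ (B : Type (max u v w' x)) (_ : K.Structure B) (_ : M ↪ₑ[K] B) (d e : Fin n → B),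
      Nonempty B ∧ SameType ψ d e ∧ Structure.RelMap r d ∧ ¬ Structure.RelMap r e := by
  -- The lift only places the ultrapower in the required universe.
  let X := ULift.{x} {φ : L.Formula (Fin n) // IsEqFree φ}
  have H : ∀ s : Finset X, ∃ d e : Fin n → M, Structure.RelMap r d ∧ ¬ Structure.RelMap r e ∧
      ∀ φ ∈ s, ((ψ.onFormula φ.down.1).Realize d ↔ (ψ.onFormula φ.down.1).Realize e) := by
    classical
    let := ψ.reduct M
    simp only [LHom.realize_onFormula] at h ⊢
    intro s
    by_contra! hs
    refine h (exists_isEqFree_realize_iff_mem (s.image ULift.down) {e | Structure.RelMap r e}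
      fun d hd e hde => by_contra fun he => ?_)
    obtain ⟨φ, hφ, hne⟩ := hs d e hd he
    have := hde φ.down (Finset.mem_image_of_mem _ hφ)
    tauto
  choose d e hd he hde using H
  -- In an empty `M` there are no tuples of positive length, and for `n = 0` the tuples `d ∅` and `e
  -- ∅` coincide.
  have : Nonempty M := by
    by_contra hM
    rw [not_nonempty_iff] at hM
    obtain rfl | hn := Nat.eq_zero_or_pos n
    · exact he ∅ (Subsingleton.elim (d ∅) (e ∅) ▸ hd ∅)
    · exact hM.elim (d ∅ ⟨0, hn⟩)
  obtain ⟨U, hU⟩ := exists_ultrafilter_mem X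
  refine ⟨(U : Filter (Finset X)).Product (fun _ => M), inferInstance, diagonal K M U,
    fun i => ultraMk U fun s => d s i,
    fun i => ultraMk U fun s => e s i,
    inferInstance, ?_, ?_, ?_⟩
  · intro φ hφ
    rw [realize_ultraMk, realize_ultraMk]
    refine eventually_congr ?_
    filter_upwards [hU ⟨φ, hφ⟩] with s hs
    exact hde s _ hs
  · rw [relMap_ultraMk]
    exact Eventually.of_forall hd
  · rw [relMap_ultraMk]
    simp [he, U.neBot.ne]

end Step

/-! ### Unions of elementary chains -/

section ElementaryChain

variable {K : FirstOrder.Language.{u, v}} {G : ℕ → Type w} [∀ i, K.Structure (G i)]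
  (f : ∀ i, G i ↪ₑ[K] G (i + 1))

/-- The embeddings of an elementary chain. -/
abbrev chainMap (i j : ℕ) (h : i ≤ j) : G i ↪[K] G j :=
  DirectedSystem.natLERec (fun i => (f i).toEmbedding) i j h

theorem chainMap_self (i : ℕ) (a : G i) : chainMap f i i le_rfl a = a :=
  (congrFun (DirectedSystem.coe_natLERec _ i i le_rfl) a).trans (Nat.leRecOn_self _)

theorem chainMap_step {i j : ℕ} (h : i ≤ j) (a : G i) :
    chainMap f i (j + 1) (h.trans j.le_succ) a = f j (chainMap f i j h a) :=
  (congrFun (DirectedSystem.coe_natLERec _ i (j + 1) _) a).trans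
    ((Nat.leRecOn_succ h a).trans
      (congrArg (f j) (congrFun (DirectedSystem.coe_natLERec _ i j h) a).symm))

theorem realize_chainMap {α : Type*} {i j : ℕ} (h : i ≤ j) {k : ℕ} (φ : K.BoundedFormula α k)
    (v : α → G i) (xs : Fin k → G i) :
    φ.Realize (chainMap f i j h ∘ v) (chainMap f i j h ∘ xs) ↔ φ.Realize v xs := by
  induction j, h using Nat.le_induction with
  | base =>
    rw [show (chainMap f i i le_rfl : G i → G i) = id from funext (chainMap_self f i)]
    rfl
  | succ j h ih =>
    rw [show (chainMap f i (j + 1) (h.trans j.le_succ) : G i → G (j + 1)) =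
        f j ∘ chainMap f i j h from funext (chainMap_step f h),
      Function.comp_assoc, Function.comp_assoc, (f j).map_boundedFormula, ih]

/-- The union of an elementary chain. -/
abbrev ChainLimit : Type w := Language.DirectLimit G (chainMap f)

/-- The inclusion of a member of an elementary chain into the union. -/
noncomputable abbrev chainOf (i : ℕ) : G i ↪[K] ChainLimit f :=
  Language.DirectLimit.of K ℕ G (chainMap f) i

theorem chainOf_chainMap {i j : ℕ} (h : i ≤ j) (a : G i) :
    chainOf f j (chainMap f i j h a) = chainOf f i a :=
  Language.DirectLimit.of_f

theorem chainOf_map (i : ℕ) (a : G i) : chainOf f (i + 1) (f i a) = chainOf f i a := by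
  rw [← chainOf_chainMap f i.le_succ a, chainMap_step f le_rfl, chainMap_self]

/-- Tarski's argument: an element of the union lies in a stage beyond `i`, to which a universal
statement transfers by elementarity of the chain maps. -/
theorem realize_chainOf {α : Type*} {k : ℕ} (φ : K.BoundedFormula α k) :
    ∀ (i : ℕ) (v : α → G i) (xs : Fin k → G i),
      φ.Realize (chainOf f i ∘ v) (chainOf f i ∘ xs) ↔ φ.Realize v xs := by
  induction φ with
  | falsum => exact fun _ _ _ => Iff.rfl
  | equal t₁ t₂ =>
    intro i v xs
    simp only [BoundedFormula.Realize, ← Sum.comp_elim, HomClass.realize_term]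
    exact (chainOf f i).injective.eq_iff
  | rel r ts =>
    intro i v xs
    simp only [BoundedFormula.Realize, ← Sum.comp_elim, HomClass.realize_term]
    exact (chainOf f i).map_rel r _
  | imp _ _ ih₁ ih₂ => exact fun i v xs => imp_congr (ih₁ i v xs) (ih₂ i v xs)
  | all φ ih =>
    intro i v xs
    constructor
    · intro H a
      rw [← ih i, Fin.comp_snoc]
      exact H _
    · intro H b
      obtain ⟨j, b, rfl⟩ := Language.DirectLimit.exists_of b
      let m := max i j
      have hi : i ≤ m := le_max_left _ _
      have hj : j ≤ m := le_max_right _ _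
      have hall := (realize_chainMap f hi φ.all v xs).2 H (chainMap f j m hj b)
      rw [← ih m, Fin.comp_snoc, chainOf_chainMap] at hall
      have e : chainOf f m ∘ chainMap f i m hi = chainOf f i := funext (chainOf_chainMap f hi)
      rwa [← Function.comp_assoc, ← Function.comp_assoc, e] at hall

/-- The members of an elementary chain are elementary in the union. -/
noncomputable def chainElementary (i : ℕ) : G i ↪ₑ[K] ChainLimit f where
  toFun := chainOf f i
  map_formula' _ φ x := by
    rw [Formula.Realize, Formula.Realize, ← realize_chainOf f φ i x]
    exact iff_of_eq (congrArg _ (Subsingleton.elim _ _))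

end ElementaryChain

/-! ### From type-preserving relations to relativities -/

section Total

variable {L K : FirstOrder.Language.{u, v}} {ψ : L →ᴸ K}

/-- A formula has finitely many free variables, so the pairs it mentions are all related at one
stage, which is elementary in the union. -/
theorem preservesTypes_chain {G : ℕ → Type w} [∀ i, K.Structure (G i)]
    (f : ∀ i, G i ↪ₑ[K] G (i + 1)) (S : ∀ i, G i → G i → Prop)
    (hS : ∀ i, PreservesTypes ψ (S i)) (hf : ∀ i a b, S i a b → S (i + 1) (f i a) (f i b)) :
    PreservesTypes ψ fun a b : ChainLimit f =>
      ∃ i a' b', S i a' b' ∧ chainOf f i a' = a ∧ chainOf f i b' = b := by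
  classical
  have hf' : ∀ i j (h : i ≤ j) a b, S i a b → S j (chainMap f i j h a) (chainMap f i j h b) := by
    intro i j h a b hab
    induction j, h using Nat.le_induction with
    | base => simpa only [chainMap_self] using hab
    | succ j h ih =>
      rw [chainMap_step f h, chainMap_step f h]
      exact hf j _ _ ih
  intro φ hφ
  choose i a b hab ha hb using fun p : {p : ChainLimit f × ChainLimit f //
    ∃ i a' b', S i a' b' ∧ chainOf f i a' = p.1 ∧ chainOf f i b' = p.2} => p.2
  let m := φ.freeVarFinset.sup i
  have hm : ∀ p : φ.freeVarFinset, i p ≤ m := fun p => Finset.le_sup p.2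
  have key := (hS m).sameType (l := fun p : φ.freeVarFinset => chainMap f _ m (hm p) (a p))
    (r := fun p => chainMap f _ m (hm p) (b p)) (fun p => hf' _ _ _ _ _ (hab p))
    (φ.restrictFreeVar id) (hφ.restrictFreeVar id)
  let := ψ.reduct (ChainLimit f)
  rw [← (chainElementary f m).map_formula, ← (chainElementary f m).map_formula,
    LHom.realize_onFormula, LHom.realize_onFormula] at key
  rw [LHom.realize_onFormula, LHom.realize_onFormula]
  refine Iff.trans (Iff.symm ?_) (key.trans ?_)
  · refine BoundedFormula.realize_restrictFreeVar _ fun p => ?_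
    exact (chainOf_chainMap f (hm p) _).trans (ha p)
  · refine BoundedFormula.realize_restrictFreeVar _ fun p => ?_
    exact (chainOf_chainMap f (hm p) _).trans (hb p)

/-- A nonempty structure with a relation preserving equality-free types. -/
structure TypedStructure (ψ : L →ᴸ K) : Type (max u v w + 1) where
  carrier : Type (max u v w)
  [str : K.Structure carrier]
  [nonempty : Nonempty carrier]
  rel : carrier → carrier → Prop
  preserves : PreservesTypes ψ rel

attribute [instance] TypedStructure.str TypedStructure.nonempty

theorem TypedStructure.exists_next (A : TypedStructure.{u, v, w} ψ) :
    ∃ (A' : TypedStructure.{u, v, w} ψ) (j : A.carrier ↪ₑ[K] A'.carrier),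
      (∀ a b, A.rel a b → A'.rel (j a) (j b)) ∧
        (∀ a, ∃ b, A'.rel (j a) b) ∧ ∀ b, ∃ a, A'.rel a (j b) := by
  obtain ⟨B', _, j, S', h, h'⟩ := PreservesTypes.exists_total_extension.{u, v, w} A.preserves
  have : Nonempty B' := A.nonempty.map j
  exact ⟨⟨B', S', h⟩, j, h'⟩

/-- An element that appears at stage `i` has partners on both sides at stage `i + 1`. -/
theorem TypedStructure.exists_full_extension_of_chain (A : ℕ → TypedStructure.{u, v, w} ψ)
    (f : ∀ i, (A i).carrier ↪ₑ[K] (A (i + 1)).carrier)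
    (hf : ∀ i a b, (A i).rel a b → (A (i + 1)).rel (f i a) (f i b))
    (hd : ∀ i a, ∃ b, (A (i + 1)).rel (f i a) b) (hr : ∀ i b, ∃ a, (A (i + 1)).rel a (f i b)) :
    ∃ (B : Type (max u v w)) (_ : K.Structure B) (j : (A 0).carrier ↪ₑ[K] B)
      (S : B → B → Prop), PreservesTypes ψ S ∧ (∀ a b, (A 0).rel a b → S (j a) (j b)) ∧
        (∀ a, ∃ b, S a b) ∧ ∀ b, ∃ a, S a b := by
  refine ⟨ChainLimit f, inferInstance, chainElementary f 0, _,
    preservesTypes_chain f (fun i => (A i).rel) (fun i => (A i).preserves) hf,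
    fun a b hab => ⟨0, a, b, hab, rfl, rfl⟩, fun a => ?_, fun b => ?_⟩
  · obtain ⟨i, a, rfl⟩ := Language.DirectLimit.exists_of a
    obtain ⟨b, hb⟩ := hd i a
    exact ⟨_, i + 1, f i a, b, hb, chainOf_map f i _, rfl⟩
  · obtain ⟨i, b, rfl⟩ := Language.DirectLimit.exists_of b
    obtain ⟨a, ha⟩ := hr i b
    exact ⟨_, i + 1, a, f i b, ha, rfl, chainOf_map f i _⟩

/-- A relation preserving equality-free types extends, over an elementary extension, to one with
full domain and range. -/
theorem PreservesTypes.exists_full_extension {B : Type (max u v w)} [K.Structure B]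
    [Nonempty B] {S : B → B → Prop} (hS : PreservesTypes ψ S) :
    ∃ (B' : Type (max u v w)) (_ : K.Structure B') (j : B ↪ₑ[K] B') (S' : B' → B' → Prop),
      PreservesTypes ψ S' ∧ (∀ a b, S a b → S' (j a) (j b)) ∧
        (∀ a, ∃ b, S' a b) ∧ ∀ b, ∃ a, S' a b := by
  choose next j hj hd hr using TypedStructure.exists_next.{u, v, w} (ψ := ψ)
  exact TypedStructure.exists_full_extension_of_chain.{u, v, w}
    (Nat.rec (motive := fun _ => TypedStructure.{u, v, w} ψ) ⟨B, S, hS⟩ fun _ => next)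
    (fun _ => j _) (fun _ => hj _) (fun _ => hd _) (fun _ => hr _)

/-- The closure under terms of a relation with full domain and range preserving equality-free
types is a relativity. -/
theorem PreservesTypes.exists_isRelativity {B : Type w} [K.Structure B] {S : B → B → Prop}
    (hS : PreservesTypes ψ S) (hd : ∀ a, ∃ b, S a b) (hr : ∀ b, ∃ a, S a b) :
    letI := ψ.reduct B
    ∃ P : B → B → Prop, IsRelativity L P ∧ ∀ a b, S a b → P a b := by
  let := ψ.reduct B
  -- The pairs of `S` serve as variables common to all terms. A predicate applied to such terms is
  -- then a single atomic formula, on whose truth the two coordinate families agree.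
  let P : B → B → Prop := fun a b => ∃ t : L.Term {p : B × B // S p.1 p.2},
    t.realize (fun p => p.1.1) = a ∧ t.realize (fun p => p.1.2) = b
  have hSP : ∀ a b, S a b → P a b := fun a b h => ⟨Term.var ⟨(a, b), h⟩, rfl, rfl⟩
  refine ⟨P, ⟨fun a => (hd a).imp fun b => hSP a b, fun b => (hr b).imp fun a => hSP a b,
    ?_, ?_⟩, hSP⟩
  · intro k r d e h
    choose t hd he using h
    obtain rfl := funext hd
    obtain rfl := funext he
    have := hS (r.formula t) trivial
    rwa [LHom.realize_onFormula, LHom.realize_onFormula, Formula.realize_rel,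
      Formula.realize_rel] at this
  · intro k f d e h
    choose t hd he using h
    obtain rfl := funext hd
    obtain rfl := funext he
    exact ⟨Term.func f t, rfl, rfl⟩

end Total

/-! ### The implications between the four conditions -/

section Main

variable {L : FirstOrder.Language.{u, v}} {n : ℕ}

/-- Every `L ∪ {R}`-structure is of the form `(N, V)`. -/
def expandEquiv (N : Type w) [(addPred L n).Structure N] :
    letI := (LHom.sumInl : L →ᴸ addPred L n).reduct N
    N ≃[addPred L n] Expand {e : Fin n → N | Structure.RelMap (newPred L n) e} :=
  letI := (LHom.sumInl : L →ᴸ addPred L n).reduct N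
  { toEquiv := _root_.Equiv.refl N
    map_fun' := fun f x => by
      obtain f | f := f
      · rfl
      · exact Empty.elim f
    map_rel' := fun {k} r x => by
      obtain r | r := r
      · exact Iff.rfl
      · change PredSymbol n k at r
        cases r
        exact Iff.rfl }

theorem exists_definition_of_forall_relativity {M : Type w} [L.Structure M]
    {U : Set (Fin n → M)}
    (h : ∀ (N : Type (max u v w x)) [L.Structure N] (V : Set (Fin n → N)),
      Nonempty (Expand U ↪ₑ[addPred L n] Expand V) →
        ∀ P : N → N → Prop, IsRelativity L P → V = relImage P V) :
    ∃ φ : L.Formula (Fin n), IsEqFree φ ∧ Expand U ⊨ defSentence φ := by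
  by_contra hU
  have hU' : ¬ ∃ φ : L.Formula (Fin n), IsEqFree φ ∧ ∀ e : Fin n → Expand U,
      ((LHom.sumInl : L →ᴸ addPred L n).onFormula φ).Realize e ↔
        Structure.RelMap (newPred L n) e := by
    rintro ⟨φ, hφ, H⟩
    exact hU ⟨φ, hφ, (realize_defSentence U φ).2 fun e =>
      (realize_onFormula_expand U φ e).symm.trans (H e)⟩
  obtain ⟨B, _, j, d, e, _, hde, hd, he⟩ :=
    exists_sameType_of_not_definable.{u, v, w, x} (newPred L n) hU'
  obtain ⟨N, _, j', S, hS, hjS, hdom, hrng⟩ :=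
    PreservesTypes.exists_full_extension.{u, v, max w x} hde.preservesTypes
  let := (LHom.sumInl : L →ᴸ addPred L n).reduct N
  obtain ⟨P, hP, hSP⟩ := hS.exists_isRelativity hdom hrng
  have key := h N {e | Structure.RelMap (newPred L n) e}
    ⟨(expandEquiv N).toElementaryEmbedding.comp (j'.comp j)⟩ P hP
  -- The tuple `e` fails `R` in `B`, hence in `N`, yet lies in the image of `R` because `d`
  -- satisfies `R`.
  have hmem : j' ∘ e ∈ relImage P {e : Fin n → N | Structure.RelMap (newPred L n) e} :=
    ⟨j' ∘ d, (j'.map_rel _ _).2 hd, fun i => hSP _ _ (hjS _ _ ⟨i, rfl, rfl⟩)⟩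
  rw [← key] at hmem
  exact he ((j'.map_rel _ _).1 hmem)

theorem mem_iff_of_relativity {M : Type w} [L.Structure M] {U : Set (Fin n → M)}
    (h : ∀ (N : Type w') [L.Structure N] (V₀ V₁ : Set (Fin n → N)),
      EqFreeEquiv (addPred L n) (Expand V₀) (Expand U) →
      EqFreeEquiv (addPred L n) (Expand V₁) (Expand U) → V₀ = V₁)
    {N : Type w'} [L.Structure N] {V : Set (Fin n → N)}
    (hV : EqFreeEquiv (addPred L n) (Expand V) (Expand U)) {P : N → N → Prop}
    (hP : IsRelativity L P) {d e : Fin n → N} (hde : ∀ i, P (d i) (e i)) : d ∈ V ↔ e ∈ V := by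
  let := graphStructure hP
  have key := h {p : N × N // P p.1 p.2} _ _ ((eqFreeEquiv_graph_fst hP V).trans hV)
    ((eqFreeEquiv_graph_snd hP V).trans hV)
  exact Set.ext_iff.1 key fun i => ⟨(d i, e i), hde i⟩

theorem eq_relImage_of_mem_iff {N : Type w} [L.Structure N] {V : Set (Fin n → N)}
    {P : N → N → Prop} (hP : IsRelativity L P)
    (h : ∀ d e : Fin n → N, (∀ i, P (d i) (e i)) → (d ∈ V ↔ e ∈ V)) : V = relImage P V := by
  ext e
  constructor
  · intro he
    choose d hd using fun i => hP.rng (e i)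
    exact ⟨d, (h d e hd).2 he, hd⟩
  · rintro ⟨d, hdV, hd⟩
    exact (h d e hd).1 hdV

theorem isEqFreeElementary_of_elementaryEmbedding {A : Type w} {B : Type w'} [L.Structure A]
    [L.Structure B] (j : A ↪ₑ[L] B) : IsEqFreeElementary L j :=
  ⟨j.injective, fun _ φ _ e => (j.map_formula φ e).symm⟩

end Main

end EqFree

theorem mainTheorem3 (L : FirstOrder.Language.{u, v}) (M : Type w) [L.Structure M] (n : ℕ)
    (U : Set (Fin n → M)) :
    List.TFAE [
      ∃ φ : L.Formula (Fin n), EqFree.IsEqFree φ ∧ EqFree.Expand U ⊨ EqFree.defSentence φ,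
      ∀ (N : Type (max u v w x)) [L.Structure N] (V : Set (Fin n → N)),
        Nonempty (EqFree.Expand U ↪ₑ[EqFree.addPred L n] EqFree.Expand V) →
          ∀ P : N → N → Prop, EqFree.IsRelativity L P → V = EqFree.relImage P V,
      ∀ (N : Type (max u v w x)) [L.Structure N] (V : Set (Fin n → N)),
        (∃ j : EqFree.Expand U → EqFree.Expand V,
          EqFree.IsEqFreeElementary (EqFree.addPred L n) j) →
          ∀ P : N → N → Prop, EqFree.IsRelativity L P → V = EqFree.relImage P V,
      ∀ (N : Type (max u v w x)) [L.Structure N] (V₀ V₁ : Set (Fin n → N)),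
        EqFree.EqFreeEquiv (EqFree.addPred L n) (EqFree.Expand V₀) (EqFree.Expand U) →
        EqFree.EqFreeEquiv (EqFree.addPred L n) (EqFree.Expand V₁) (EqFree.Expand U) →
          V₀ = V₁] := by
  tfae_have 1 → 4 := by
    rintro ⟨φ, hφ, h⟩ N _ V₀ V₁ h₀ h₁
    have hσ := EqFree.isEqFree_defSentence hφ
    have H₀ := (EqFree.realize_defSentence V₀ φ).1 ((h₀ _ hσ).2 h)
    have H₁ := (EqFree.realize_defSentence V₁ φ).1 ((h₁ _ hσ).2 h)
    ext e
    exact (H₀ e).symm.trans (H₁ e)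
  tfae_have 4 → 3 := by
    rintro h N _ V ⟨j, hj⟩ P hP
    exact EqFree.eq_relImage_of_mem_iff hP fun d e hde =>
      EqFree.mem_iff_of_relativity h hj.eqFreeEquiv.symm hP hde
  tfae_have 3 → 2 := by
    rintro h N _ V ⟨j⟩ P hP
    exact h N V ⟨j, EqFree.isEqFreeElementary_of_elementaryEmbedding j⟩ P hP
  tfae_have 2 → 1 := fun h => EqFree.exists_definition_of_forall_relativity.{u, v, w, x} h
  tfae_finish
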